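/- Let $G$ be a finite simple graph of order $n \ge 4$ whose edges are colored arbitrarily, and for a vertex $v$ let $d^c(v)$ be the color degree of $v$, that is, the number of colors that appear on the edges incident to $v$. A $4$-cycle $C_4$ in $G$ is properly colored if any two adjacent edges of it have distinct colors. (a) If $\sum_{v} d^c(v) \ge \frac{n(n+1)}{2}+1$, then $G$ contains a properly colored $C_4$. (b) If $\sum_{v} d^c(v) = \frac{n(n+1)}{2}$ and $G$ contains no properly colored $C_4$, then $G$ is complete and has a layered structure whose center part is a rainbow triangle (a triangle whose three edges have distinct colors). That is, there are vertex sets $T = S_0 \subsetneq S_1 \subsetneq \dots \subsetneq S_m = V(G)$ such that $T$ is the vertex set of a rainbow triangle and, for each $0 \le i < m$, one of the following holds: 1. $S_{i+1} = S_i \cup \{v\}$ for a vertex $v \notin S_i$, and all edges from $v$ to $S_i$ have one and the same color, which appears on no edge inside $S_i$; 2. $S_{i+1} = S_i \cup \{u,v,w\}$ for three distinct vertices $u,v,w \notin S_i$, the edges $uv$, $vw$, $uw$ have three distinct colors (say red, blue, green, respectively), none of which appears on an edge inside $S_i$, and all edges from $u$ to $S_i$ are red, all edges from $v$ to $S_i$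 are blue, and all edges from $w$ to $S_i$ are green. -/

import Mathlib

/-! An edge-colored graph is a `SimpleGraph` with a `SimpleGraph.EdgeLabeling`: an arbitrary
assignment of a color to each of its edges. -/

namespace EdgeColoredGraph

variable {V α : Type*} {G : SimpleGraph V}

/-- `xy` is an edge of `G` and its color is `k`. -/
def HasColor (C : G.EdgeLabeling α) (x y : V) (k : α) : Prop :=
  ∃ h : G.Adj x y, C.get x y h = k

/-- The color degree of `v`: the number of colors that appear on the edges at `v`. -/
noncomputable def colorDegree (C : G.EdgeLabeling α) (v : V) : ℕ :=
  {k : α | ∃ w : V, HasColor C v w k}.ncard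

/-- The color `k` appears on no edge with both ends in `S`. -/
def ColorFreeOn (C : G.EdgeLabeling α) (k : α) (S : Set V) : Prop :=
  ∀ x ∈ S, ∀ y ∈ S, ¬ HasColor C x y k

/-- `G` contains a properly colored `C₄`: a (not necessarily induced) 4-cycle `a b c d` of `G`
in which any two adjacent edges have distinct colors. (Consecutive vertices are distinct because
they are adjacent.) -/
def HasProperlyColoredC4 (C : G.EdgeLabeling α) : Prop :=
  ∃ (a b c d : V) (k₁ k₂ k₃ k₄ : α), a ≠ c ∧ b ≠ d ∧
    HasColor C a b k₁ ∧ HasColor C b c k₂ ∧ HasColor C c d k₃ ∧ HasColor C d a k₄ ∧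
    k₁ ≠ k₂ ∧ k₂ ≠ k₃ ∧ k₃ ≠ k₄ ∧ k₄ ≠ k₁

/-- `T` is the vertex set of a rainbow triangle. -/
def IsRainbowTriangle (C : G.EdgeLabeling α) (T : Set V) : Prop :=
  ∃ (u v w : V) (r b g : α), T = {u, v, w} ∧
    HasColor C u v r ∧ HasColor C v w b ∧ HasColor C u w g ∧ r ≠ b ∧ b ≠ g ∧ r ≠ g

/-- `LayeredOver C T S`: the part of `G` on `S` is obtained from its center part, which lives on
`T`, by adding layers one at a time around what has been built so far. A layer is either
* one new vertex `v`, joined to everything inside in a single color, or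
* a new rainbow triangle `uvw` with `uv` red, `vw` blue, `uw` green, in which `u`, `v`, `w` are
  joined to everything inside in red, blue and green respectively,

where the colors of the new layer do not appear inside. -/
inductive LayeredOver (C : G.EdgeLabeling α) (T : Set V) : Set V → Prop
  | center : LayeredOver C T T
  | vertex {S : Set V} (hS : LayeredOver C T S) (v : V) (hv : v ∉ S) (k : α)
      (hk : ColorFreeOn C k S) (hvS : ∀ x ∈ S, HasColor C v x k) :
      LayeredOver C T (insert v S)
  | triangle {S : Set V} (hS : LayeredOver C T S) (u v w : V)
      (hu : u ∉ S) (hv : v ∉ S) (hw : w ∉ S) (r b g : α)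
      (hrb : r ≠ b) (hbg : b ≠ g) (hrg : r ≠ g)
      (hr : ColorFreeOn C r S) (hb : ColorFreeOn C b S) (hg : ColorFreeOn C g S)
      (huv : HasColor C u v r) (hvw : HasColor C v w b) (huw : HasColor C u w g)
      (huS : ∀ x ∈ S, HasColor C u x r) (hvS : ∀ x ∈ S, HasColor C v x b)
      (hwS : ∀ x ∈ S, HasColor C w x g) :
      LayeredOver C T ({u, v, w} ∪ S)

end EdgeColoredGraph

/-! Edges whose color is repeated at both ends can be deleted without changing any color degree
(`exists_reduced`). Afterwards every edge is an arc in at least one direction, where an arc from `x`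
to `y` means that deleting `x` costs `y` a color. A directed 4-cycle of arcs is properly colored.

Deleting `v` costs at most n plus the number of colors on arcs leaving `v` minus the number of
nonneighbors of `v`, itself included (`colorDegreeSum_add_le`). If some vertex has no more
out-colors than nonneighbors, the cost is at most n, and n(n+1)/2 follows by induction. Such a
vertex exists when n ≥ 4 (`exists_card_outColors_le`): two arcs of different colors from `v` to `b`
and `c` force the arcs leaving `b` to end at `v` or at nonneighbors of `c`, and counting then
confines all arcs leaving `v`, `b`, `c` to this triangle.

In the equality case every deletion costs at least n, which forces completeness
(`completeOn_of_erase`); hence no edge had been deleted at the start. The arcs then behave like a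
tournament without directed 4-cycles: a vertex of maximum out-degree dominates everything or lies in
a directed triangle that dominates the rest (`exists_layer`). This is the outermost layer, and
removing it preserves equality. -/

namespace EdgeColoredGraph

open Finset

/-! ### Arcs, the cost of deleting a vertex, and the extremal bound. -/

section PartialColoring

variable {V α : Type*}

/-- An edge-colored graph on `V` given by its table of colors: `f x y = some k` if `xy` is an edge
of color `k`, and `f x y = none` if `xy` is not an edge. -/
structure IsColorTable (f : V → V → Option α) : Prop where
  symm : ∀ x y, f x y = f y x
  irrefl : ∀ x, f x x = none

/-- No 4-cycle of the table `f` is properly colored. -/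
def NoProperC4 (f : V → V → Option α) : Prop :=
  ∀ a b c d, a ≠ c → b ≠ d → f a b ≠ none → f b c ≠ none → f c d ≠ none → f d a ≠ none →
    f a b ≠ f b c → f b c ≠ f c d → f c d ≠ f d a → f d a ≠ f a b → False

/-- `xy` is an edge, and it is the only edge from `y` to `S` that has its color. -/
def Arc (f : V → V → Option α) (S : Finset V) (x y : V) : Prop :=
  f x y ≠ none ∧ ∀ z ∈ S, f y z = f y x → z = x

/-- Every edge inside `S` is the only edge of its color at one of its ends. -/
def Reduced (f : V → V → Option α) (S : Finset V) : Prop :=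
  ∀ x ∈ S, ∀ y ∈ S, f x y ≠ none → Arc f S x y ∨ Arc f S y x

/-- Any two distinct vertices of `S` are adjacent. -/
def CompleteOn (f : V → V → Option α) (S : Finset V) : Prop :=
  ∀ x ∈ S, ∀ y ∈ S, x ≠ y → f x y ≠ none

lemma Arc.mono {f : V → V → Option α} {S T : Finset V} (h : T ⊆ S) {x y : V} (hxy : Arc f S x y) :
    Arc f T x y := ⟨hxy.1, fun z hz => hxy.2 z (h hz)⟩

lemma Reduced.mono {f : V → V → Option α} {S T : Finset V} (h : T ⊆ S) (hS : Reduced f S) :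
    Reduced f T := fun x hx y hy hxy =>
  (hS x (h hx) y (h hy) hxy).imp (Arc.mono h) (Arc.mono h)

open Classical in
/-- The number of colors of the edges from `v` to `S`. -/
noncomputable def colorDegreeIn (f : V → V → Option α) (S : Finset V) (v : V) : ℕ :=
  ((S.image (f v)).erase none).card

/-- The sum of the color degrees in the graph induced on `S`. -/
noncomputable def colorDegreeSum (f : V → V → Option α) (S : Finset V) : ℕ :=
  ∑ v ∈ S, colorDegreeIn f S v

open Classical in
/-- The heads in `S` of the arcs that leave `x`. -/
noncomputable def outs (f : V → V → Option α) (S : Finset V) (x : V) : Finset V :=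
  {y ∈ S | Arc f S x y}

open Classical in
/-- The colors of the arcs from `x` to `S`. -/
noncomputable def outColors (f : V → V → Option α) (S : Finset V) (x : V) : Finset (Option α) :=
  (outs f S x).image (f x)

open Classical in
/-- The vertices of `S` that are not adjacent to `x`, including `x` itself if it is in `S`. -/
noncomputable def nonNeighbors (f : V → V → Option α) (S : Finset V) (x : V) : Finset V :=
  {y ∈ S | f x y = none}

variable {f : V → V → Option α} {S : Finset V}

lemma mem_outs {x y : V} : y ∈ outs f S x ↔ y ∈ S ∧ Arc f S x y := by
  classical
  simp [outs]

lemma mem_nonNeighbors {x y : V} : y ∈ nonNeighbors f S x ↔ y ∈ S ∧ f x y = none := by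
  classical
  simp [nonNeighbors]

lemma IsColorTable.ne_of_arc (hf : IsColorTable f) {x y : V} (h : Arc f S x y) : x ≠ y := by
  rintro rfl
  exact h.1 (hf.irrefl x)

lemma card_outColors_le (v : V) : (outColors f S v).card ≤ (outs f S v).card := by
  classical
  exact card_image_le

-- The color of `uv` is lost at `u` only if no other edge at `u` carries it, that is, if `v` sends
-- an arc to `u`.
open Classical in
lemma colorDegreeIn_le_erase (hf : IsColorTable f) (u v : V) (hu : u ∈ S) :
    colorDegreeIn f S u ≤ colorDegreeIn f (S.erase v) u + if u ∈ outs f S v then 1 else 0 := by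
  unfold colorDegreeIn
  split_ifs with h
  · have : (S.image (f u)).erase none ⊆ insert (f u v) (((S.erase v).image (f u)).erase none) := by
      intro k
      simp only [mem_erase, mem_image, mem_insert, ne_eq]
      rintro ⟨hk, w, hw, rfl⟩
      by_cases hwv : w = v
      · exact Or.inl (by rw [hwv])
      · exact Or.inr ⟨hk, w, ⟨hwv, hw⟩, rfl⟩
    exact (card_le_card this).trans (card_insert_le _ _)
  · have : (S.image (f u)).erase none ⊆ ((S.erase v).image (f u)).erase none := by
      intro k
      simp only [mem_erase, mem_image, ne_eq]
      rintro ⟨hk, w, hw, rfl⟩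
      refine ⟨hk, ?_⟩
      by_cases hwv : w = v
      · subst hwv
        have h1 : ¬ Arc f S w u := fun h' => h (mem_outs.2 ⟨hu, h'⟩)
        simp only [Arc, not_and, not_forall] at h1
        obtain ⟨z, hz, hz1, hz2⟩ := h1 (by rwa [hf.symm w u])
        exact ⟨z, ⟨hz2, hz⟩, hz1⟩
      · exact ⟨w, ⟨hwv, hw⟩, rfl⟩
    simpa using card_le_card this

/-- Each edge at `v` that is not an outgoing arc contributes at most one color; the outgoing arcs
contribute exactly `outColors`. -/
lemma colorDegreeIn_add_le (v : V) :
    colorDegreeIn f S v + (outs f S v).card + (nonNeighbors f S v).card ≤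
      S.card + (outColors f S v).card := by
  classical
  have h1 : (S.image (f v)).erase none ⊆
      outColors f S v ∪ ((S \ nonNeighbors f S v) \ outs f S v).image (f v) := by
    intro k
    simp only [mem_erase, mem_image, mem_union, outColors, mem_sdiff, ne_eq, mem_nonNeighbors]
    rintro ⟨hk, w, hw, rfl⟩
    by_cases h : w ∈ outs f S v
    · exact Or.inl ⟨w, h, rfl⟩
    · exact Or.inr ⟨w, ⟨⟨hw, fun h' => hk h'.2⟩, h⟩, rfl⟩
  have h2 := (card_le_card h1).trans (card_union_le _ _)
  have h3 : (((S \ nonNeighbors f S v) \ outs f S v).image (f v)).card ≤ _ := card_image_le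
  have hs : outs f S v ⊆ S \ nonNeighbors f S v := by
    intro w hw
    rw [mem_outs] at hw
    simp [mem_nonNeighbors, hw.1, hw.2.1]
  have hn : nonNeighbors f S v ⊆ S := fun w hw => (mem_nonNeighbors.1 hw).1
  rw [card_sdiff_of_subset hs, card_sdiff_of_subset hn] at h3
  have h4 := card_le_card hs
  rw [card_sdiff_of_subset hn] at h4
  have h5 := card_le_card hn
  unfold colorDegreeIn
  omega

open Classical in
/-- The loss in the color degree sum when a vertex is deleted. -/
lemma colorDegreeSum_add_le (hf : IsColorTable f) {v : V} (hv : v ∈ S) :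
    colorDegreeSum f S + (nonNeighbors f S v).card ≤
      colorDegreeSum f (S.erase v) + S.card + (outColors f S v).card := by
  unfold colorDegreeSum
  rw [← add_sum_erase _ _ hv]
  have h1 : ∑ u ∈ S.erase v, colorDegreeIn f S u ≤
      ∑ u ∈ S.erase v, (colorDegreeIn f (S.erase v) u + if u ∈ outs f S v then 1 else 0) := by
    exact sum_le_sum fun u hu => colorDegreeIn_le_erase hf u v (mem_of_mem_erase hu)
  rw [sum_add_distrib, ← sum_filter, sum_const, smul_eq_mul, mul_one] at h1
  have h2 : ({u ∈ S.erase v | u ∈ outs f S v} : Finset V).card ≤ (outs f S v).card :=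
    card_le_card fun u hu => (mem_filter.1 hu).2
  have := colorDegreeIn_add_le (f := f) (S := S) v
  omega

lemma colorDegreeIn_add_card_nonNeighbors_le (v : V) :
    colorDegreeIn f S v + (nonNeighbors f S v).card ≤ S.card := by
  have := colorDegreeIn_add_le (f := f) (S := S) v
  have := card_outColors_le (f := f) (S := S) v
  omega

lemma self_mem_nonNeighbors (hf : IsColorTable f) {v : V} (hv : v ∈ S) :
    v ∈ nonNeighbors f S v := mem_nonNeighbors.2 ⟨hv, hf.irrefl v⟩

lemma card_nonNeighbors_pos (hf : IsColorTable f) {v : V} (hv : v ∈ S) :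
    1 ≤ (nonNeighbors f S v).card := card_pos.2 ⟨v, self_mem_nonNeighbors hf hv⟩

lemma exists_two_outs {v : V} (h : 2 ≤ (outColors f S v).card) :
    ∃ b ∈ outs f S v, ∃ c ∈ outs f S v, f v b ≠ f v c := by
  classical
  obtain ⟨x, hx, y, hy, hxy⟩ := one_lt_card.1 h
  simp only [outColors, mem_image] at hx hy
  obtain ⟨b, hb, rfl⟩ := hx
  obtain ⟨c, hc, rfl⟩ := hy
  exact ⟨b, hb, c, hc, hxy⟩

/-- If two arcs of different colors go from `v` to `b` and `c`, then any other common neighbor of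
`b` and `c` is joined to them in one color. -/
lemma color_eq_of_outs (hf : IsColorTable f) (hC : NoProperC4 f) {v b c : V}
    (hb : b ∈ outs f S v) (hc : c ∈ outs f S v) (hbc : f v b ≠ f v c) {x : V} (hx : x ∈ S)
    (hxv : x ≠ v) (hxb : f x b ≠ none) (hxc : f x c ≠ none) : f x b = f x c := by
  by_contra hne
  rw [mem_outs] at hb hc
  -- The cycle `v b x c` is proper at `b` and `c` because the arcs from `v` have colors unique
  -- there, and at `v` by `hbc`.
  refine hC v b x c hxv.symm (fun h => hbc (h ▸ rfl)) hb.2.1 (by rwa [hf.symm]) hxc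
    (by rw [hf.symm]; exact hc.2.1) ?_ (by rwa [hf.symm b x]) ?_ ?_
  · exact fun h => hxv (hb.2.2 x hx (h.symm.trans (hf.symm _ _)))
  · exact fun h => hxv (hc.2.2 x hx ((hf.symm _ _).trans h))
  · rw [hf.symm c v]; exact hbc.symm

-- If an arc from `b` ended at a neighbor `y ≠ v` of `c`, then `yb` and `yc` would share a color,
-- although that of `yb` is unique at `y`.
open Classical in
lemma outs_subset (hf : IsColorTable f) (hC : NoProperC4 f) {v b c : V}
    (hb : b ∈ outs f S v) (hc : c ∈ outs f S v) (hbc : f v b ≠ f v c) :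
    outs f S b ⊆ insert v (nonNeighbors f S c) := by
  intro y hy
  rw [mem_outs] at hy
  rw [mem_insert, mem_nonNeighbors, or_iff_not_imp_left]
  refine fun hyv => ⟨hy.1, ?_⟩
  by_contra hcy
  have h := color_eq_of_outs hf hC hb hc hbc hy.1 hyv (by rw [hf.symm]; exact hy.2.1)
    (by rwa [hf.symm])
  exact hbc (by rw [hy.2.2 c (mem_outs.1 hc).1 h.symm])

open Classical in
/-- If all vertices have many out-colors, then two arcs of different colors from the same vertex
lie in a triangle that has no other outgoing arcs. -/
lemma outs_eq_pair (hf : IsColorTable f) (hC : NoProperC4 f)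
    (hS : ∀ v ∈ S, (nonNeighbors f S v).card < (outColors f S v).card) {v b c : V} (hv : v ∈ S)
    (hb : b ∈ outs f S v) (hc : c ∈ outs f S v) (hbc : f v b ≠ f v c) :
    outs f S v = {b, c} ∧ outs f S b = {v, c} := by
  -- The inclusions for `b` and for `c` bound the nonneighbors of each by those of the other, so
  -- both are equalities.
  have key : ∀ {v b c : V}, v ∈ S → b ∈ outs f S v → c ∈ outs f S v → f v b ≠ f v c →
      outs f S b = insert v (nonNeighbors f S c) := by
    intro v b c hv hb hc hbc
    have h1 := card_le_card (outs_subset hf hC hb hc hbc)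
    have h2 := card_le_card (outs_subset hf hC hc hb hbc.symm)
    have h3 := hS b (mem_outs.1 hb).1
    have h4 := hS c (mem_outs.1 hc).1
    have h5 := card_outColors_le (f := f) (S := S) b
    have h6 := card_outColors_le (f := f) (S := S) c
    have h7 := card_insert_le v (nonNeighbors f S c)
    have h8 := card_insert_le v (nonNeighbors f S b)
    exact eq_of_subset_of_card_le (outs_subset hf hC hb hc hbc) (by omega)
  have hbS := (mem_outs.1 hb).1
  have hcS := (mem_outs.1 hc).1
  have hcv : c ≠ v := (hf.ne_of_arc (mem_outs.1 hc).2).symm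
  have hbv : b ≠ v := (hf.ne_of_arc (mem_outs.1 hb).2).symm
  have eb := key hv hb hc hbc
  have ec := key hv hc hb hbc.symm
  have hbc' : c ∈ outs f S b := by
    rw [eb]; exact mem_insert_of_mem (self_mem_nonNeighbors hf hcS)
  have hcb' : b ∈ outs f S c := by
    rw [ec]; exact mem_insert_of_mem (self_mem_nonNeighbors hf hbS)
  have hbv' : v ∈ outs f S b := by rw [eb]; exact mem_insert_self _ _
  have hcv' : v ∈ outs f S c := by rw [ec]; exact mem_insert_self _ _
  have h1 : f b v ≠ f b c := fun h => hcv ((mem_outs.1 hb).2.2 c hcS h.symm)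
  have h2 : f c v ≠ f c b := fun h => hbv ((mem_outs.1 hc).2.2 b hbS h.symm)
  have ev1 := key hbS hbv' hbc' h1
  have ev2 := key hcS hcv' hcb' h2
  -- Another nonneighbor of `c` would receive an arc from `b` by `eb`, and yet be a nonneighbor of
  -- `b` by `ev1` and `ev2`.
  have hnon : nonNeighbors f S c = {c} := by
    refine eq_singleton_iff_unique_mem.2 ⟨self_mem_nonNeighbors hf hcS, fun x hx => ?_⟩
    by_contra hxc
    have h3 : x ∈ outs f S b := by rw [eb]; exact mem_insert_of_mem hx
    have h4 : x ∈ outs f S v := by rw [ev1]; exact mem_insert_of_mem hx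
    rw [ev2, mem_insert, mem_nonNeighbors] at h4
    rcases h4 with h4 | h4
    · exact hxc h4
    · exact (mem_outs.1 h3).2.1 h4.2
  rw [ev1, eb, hnon]
  exact ⟨rfl, rfl⟩

/-- Some vertex can be deleted without losing more than `|S|`. -/
lemma exists_card_outColors_le (hf : IsColorTable f) (hC : NoProperC4 f) (hr : Reduced f S)
    (hS : 4 ≤ S.card) :
    ∃ v ∈ S, (outColors f S v).card ≤ (nonNeighbors f S v).card := by
  classical
  by_contra! hcon
  have key : ∀ v ∈ S, ∃ b c, outs f S v = {b, c} ∧ v ∈ outs f S b ∧ v ∈ outs f S c := by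
    intro v hv
    obtain ⟨b, hb, c, hc, hbc⟩ := exists_two_outs (f := f) (S := S) (v := v)
      (by have := hcon v hv; have := card_nonNeighbors_pos hf hv; omega)
    refine ⟨b, c, (outs_eq_pair hf hC hcon hv hb hc hbc).1, ?_, ?_⟩
    · rw [(outs_eq_pair hf hC hcon hv hb hc hbc).2]; simp
    · rw [(outs_eq_pair hf hC hcon hv hc hb hbc.symm).2]; simp
  have hsym : ∀ x ∈ S, ∀ y ∈ outs f S x, x ∈ outs f S y := by
    intro x hx y hy
    obtain ⟨b, c, h, hb, hc⟩ := key x hx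
    rw [h, mem_insert, mem_singleton] at hy
    rcases hy with rfl | rfl <;> assumption
  obtain ⟨v, hv⟩ := card_pos.1 (show 0 < S.card by omega)
  obtain ⟨b, hb, c, hc, hbc⟩ := exists_two_outs (f := f) (S := S) (v := v)
    (by have := hcon v hv; have := card_nonNeighbors_pos hf hv; omega)
  have ev := (outs_eq_pair hf hC hcon hv hb hc hbc).1
  obtain ⟨x, hx, hxn⟩ := exists_mem_notMem_of_card_lt_card
    (show ({v, b, c} : Finset V).card < S.card from lt_of_le_of_lt card_le_three (by omega))
  simp only [mem_insert, mem_singleton, not_or] at hxn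
  have hxv : x ∉ outs f S v := by
    rw [ev]; simp [hxn]
  -- Only two arcs leave `v`, so `v` has no nonneighbor but itself. The edge to a fourth vertex
  -- would then be a further arc leaving `v`, since all arcs are reversible by `hsym`.
  have hadj : ∀ x ∈ S, x ≠ v → f v x ≠ none := by
    intro x hx hxv h
    have h2 := hcon v hv
    have h3 := card_outColors_le (f := f) (S := S) v
    have h4 : (outs f S v).card ≤ 2 := by rw [ev]; exact card_le_two
    have h5 : ({v, x} : Finset V).card ≤ (nonNeighbors f S v).card := card_le_card (by
      intro y hy
      rw [mem_insert, mem_singleton] at hy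
      rcases hy with rfl | rfl
      · exact self_mem_nonNeighbors hf hv
      · exact mem_nonNeighbors.2 ⟨hx, h⟩)
    rw [card_pair hxv.symm] at h5
    omega
  rcases hr v hv x hx (hadj x hx hxn.1) with h | h
  · exact hxv (mem_outs.2 ⟨hx, h⟩)
  · exact hxv (hsym x hx v (mem_outs.2 ⟨hv, h⟩))

open Classical in
/-- If deleting `v` leaves a complete graph, and `v` and each of its nonneighbors have many
out-colors, then the whole graph is complete. -/
lemma completeOn_of_erase (hf : IsColorTable f) (hC : NoProperC4 f) (hr : Reduced f S)
    {v : V} (hv : v ∈ S) (hSv : CompleteOn f (S.erase v))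
    (hS : ∀ u ∈ S, (nonNeighbors f S u).card ≤ (outColors f S u).card) : CompleteOn f S := by
  have hvadj : ∀ u ∈ S, u ≠ v → f v u ≠ none := by
    intro u hu huv hnone
    have two : ∀ x ∈ S, ∀ y ∈ S, x ≠ y → f x y = none → 2 ≤ (outColors f S x).card := by
      intro x hx y hy hxy h
      refine le_trans ?_ (hS x hx)
      rw [← card_pair hxy]
      refine card_le_card fun z hz => ?_
      rw [mem_insert, mem_singleton] at hz
      rcases hz with rfl | rfl
      · exact self_mem_nonNeighbors hf hx
      · exact mem_nonNeighbors.2 ⟨hy, h⟩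
    have hnone' : f u v = none := by rw [hf.symm, hnone]
    obtain ⟨b, hb, c, hc, hbc⟩ := exists_two_outs (two v hv u hu huv.symm hnone)
    obtain ⟨x, hx, y, hy, hxy⟩ := exists_two_outs (two u hu v hv huv hnone')
    have adj : ∀ p ∈ S, ∀ q ∈ S, p ≠ v → q ≠ v → p ≠ q → f p q ≠ none := fun p hp q hq hpv hqv =>
      hSv p (mem_erase.2 ⟨hpv, hp⟩) q (mem_erase.2 ⟨hqv, hq⟩)
    have outsv : ∀ z ∈ outs f S v, z ∈ S ∧ z ≠ v ∧ z ≠ u ∧ f v z ≠ none := by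
      intro z hz
      rw [mem_outs] at hz
      exact ⟨hz.1, (hf.ne_of_arc hz.2).symm, fun h => hz.2.1 (h ▸ hnone), hz.2.1⟩
    have outsu : ∀ z ∈ outs f S u, z ∈ S ∧ z ≠ u ∧ z ≠ v := by
      intro z hz
      rw [mem_outs] at hz
      exact ⟨hz.1, (hf.ne_of_arc hz.2).symm, fun h => hz.2.1 (h ▸ hnone')⟩
    -- The edge `cy` can be an arc in neither direction: by `outs_subset`, its head would have to be
    -- nonadjacent to `b` or to `x`.
    have main : ∀ b ∈ outs f S v, ∀ c ∈ outs f S v, f v b ≠ f v c → ∀ x ∈ outs f S u,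
        ∀ y ∈ outs f S u, f u x ≠ f u y → c ≠ x → c ≠ y → y ≠ b → False := by
      intro b hb c hc hbc x hx y hy hxy hcx hcy hyb
      obtain ⟨hbS, hbv, hbu, hvb⟩ := outsv b hb
      obtain ⟨hcS, hcv, hcu, hvc⟩ := outsv c hc
      obtain ⟨hxS, hxu, hxv⟩ := outsu x hx
      obtain ⟨hyS, hyu, hyv⟩ := outsu y hy
      rcases hr c hcS y hyS (adj c hcS y hyS hcv hyv hcy) with h | h
      · have := outs_subset hf hC hc hb hbc.symm (mem_outs.2 ⟨hyS, h⟩)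
        rw [mem_insert, mem_nonNeighbors] at this
        rcases this with h | h
        · exact hyv h
        · exact adj b hbS y hyS hbv hyv hyb.symm h.2
      · have := outs_subset hf hC hy hx hxy.symm (mem_outs.2 ⟨hcS, h⟩)
        rw [mem_insert, mem_nonNeighbors] at this
        rcases this with h | h
        · exact hcu h
        · exact adj x hxS c hcS hxv hcv hcx.symm h.2
    -- This rules out {b, c} = {x, y}; otherwise the two pairs can be renamed to fit `main`.
    have hcol : f u b = f u c := by
      obtain ⟨hbS, hbv, hbu, hvb⟩ := outsv b hb
      obtain ⟨hcS, hcv, hcu, hvc⟩ := outsv c hc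
      exact color_eq_of_outs hf hC hb hc hbc hu huv (adj u hu b hbS huv hbv hbu.symm)
        (adj u hu c hcS huv hcv hcu.symm)
    have hbc' : b ≠ c := fun h => hbc (h ▸ rfl)
    have hxy' : x ≠ y := fun h => hxy (h ▸ rfl)
    by_cases h1 : c ≠ x ∧ c ≠ y
    · by_cases h2 : y = b
      · exact main b hb c hc hbc y hy x hx hxy.symm h1.2 h1.1 (h2 ▸ hxy')
      · exact main b hb c hc hbc x hx y hy hxy h1.1 h1.2 h2
    · have h3 : b ≠ x ∧ b ≠ y := by
        constructor <;> rintro rfl <;> refine h1 ⟨?_, ?_⟩ <;> rintro rfl <;> simp_all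
      by_cases h2 : y = c
      · exact main c hc b hb hbc.symm y hy x hx hxy.symm h3.2 h3.1 (h2 ▸ hxy')
      · exact main c hc b hb hbc.symm x hx y hy hxy h3.1 h3.2 h2
  intro x hx y hy hxy
  by_cases hxv : x = v
  · subst hxv; exact hvadj y hy hxy.symm
  by_cases hyv : y = v
  · subst hyv; rw [hf.symm]; exact hvadj x hx hxy
  exact hSv x (mem_erase.2 ⟨hxv, hx⟩) y (mem_erase.2 ⟨hyv, hy⟩) hxy

lemma colorDegreeSum_add_card_le (hf : IsColorTable f) :
    colorDegreeSum f S + S.card ≤ S.card * S.card := by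
  have h : ∑ v ∈ S, (colorDegreeIn f S v + 1) ≤ ∑ v ∈ S, S.card := sum_le_sum fun v hv => by
    have := colorDegreeIn_add_card_nonNeighbors_le (f := f) (S := S) v
    have := card_nonNeighbors_pos hf hv
    omega
  simpa [sum_add_distrib, colorDegreeSum] using h

/-- On three vertices, the maximum color degree sum is attained only if each vertex has color
degree two. -/
lemma colorDegreeIn_eq_of_card_three (hf : IsColorTable f) (hS : S.card = 3)
    (h : colorDegreeSum f S = 6) : ∀ v ∈ S, colorDegreeIn f S v = 2 := by
  have hle : ∀ v ∈ S, colorDegreeIn f S v ≤ 2 := fun v hv => by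
    have := colorDegreeIn_add_card_nonNeighbors_le (f := f) (S := S) v
    have := card_nonNeighbors_pos hf hv
    omega
  refine (sum_eq_sum_iff_of_le hle).1 ?_
  rw [sum_const, hS]
  exact h

/-- The bound on the color degree sum, and completeness in the case of equality. -/
theorem two_mul_colorDegreeSum_le (hf : IsColorTable f) (hC : NoProperC4 f) (hr : Reduced f S) :
    2 * colorDegreeSum f S ≤ S.card * (S.card + 1) ∧
      (2 * colorDegreeSum f S = S.card * (S.card + 1) → CompleteOn f S) := by
  classical
  induction S using Finset.strongInduction with
  | H S ih =>
  rcases Nat.lt_or_ge S.card 4 with hlt | hge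
  · have h1 := colorDegreeSum_add_card_le (S := S) hf
    refine ⟨?_, fun h => ?_⟩
    -- For n ≤ 3, n(n-1) ≤ n(n+1)/2, with equality only for n = 0 and n = 3.
    · interval_cases S.card <;> omega
    · obtain h0 | h3 : S.card = 0 ∨ S.card = 3 := by
        interval_cases S.card <;> omega
      · rw [card_eq_zero] at h0
        simp [h0, CompleteOn]
      · intro x hx y hy hxy hnone
        rw [h3] at h
        have h4 := colorDegreeIn_eq_of_card_three hf h3 (by omega) x hx
        have h5 := colorDegreeIn_add_card_nonNeighbors_le (f := f) (S := S) x
        have h6 : 1 < (nonNeighbors f S x).card := one_lt_card.2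
          ⟨x, self_mem_nonNeighbors hf hx, y, mem_nonNeighbors.2 ⟨hy, hnone⟩, hxy⟩
        omega
  · have step : ∀ u ∈ S, 2 * colorDegreeSum f (S.erase u) + 2 * S.card ≤ S.card * (S.card + 1) ∧
        (2 * colorDegreeSum f (S.erase u) + 2 * S.card = S.card * (S.card + 1) →
          CompleteOn f (S.erase u)) := by
      intro u hu
      have h1 := ih _ (erase_ssubset hu) (hr.mono (erase_subset u S))
      have h2 := card_erase_add_one hu
      rw [← h2]
      refine ⟨by nlinarith [h1.1], fun h => h1.2 (by nlinarith [h])⟩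
    obtain ⟨v, hv, hvle⟩ := exists_card_outColors_le hf hC hr hge
    have h1 := colorDegreeSum_add_le hf hv
    have h2 := step v hv
    refine ⟨by omega, fun h => ?_⟩
    refine completeOn_of_erase hf hC hr hv (h2.2 (by omega)) fun u hu => ?_
    -- By equality and the bound for `S.erase u`, deleting any `u` costs at least `S.card`.
    have h3 := colorDegreeSum_add_le hf hu
    have h4 := (step u hu).1
    omega

end PartialColoring

/-! ### Structure of complete reduced tables: peeling off layers. -/

section Layers

variable {V α : Type*} {f : V → V → Option α} {S : Finset V}

/-- A directed 4-cycle is properly colored. -/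
lemma not_directed_C4 (hf : IsColorTable f) (hC : NoProperC4 f) {a b c d : V} (ha : a ∈ S)
    (hb : b ∈ S) (hc : c ∈ S) (hd : d ∈ S) (hac : a ≠ c) (hbd : b ≠ d) (hab : Arc f S a b)
    (hbc : Arc f S b c) (hcd : Arc f S c d) (hda : Arc f S d a) : False := by
  -- Each arc's color is unique at its head, so it differs from that of the next arc.
  refine hC a b c d hac hbd hab.1 hbc.1 hcd.1 hda.1 ?_ ?_ ?_ ?_
  · exact fun h => hac.symm (hab.2 c hc (h.symm.trans (hf.symm _ _)))
  · exact fun h => hbd.symm (hbc.2 d hd (h.symm.trans (hf.symm _ _)))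
  · exact fun h => hac (hcd.2 a ha (h.symm.trans (hf.symm _ _)))
  · exact fun h => hbd (hda.2 b hb (h.symm.trans (hf.symm _ _)))

/-- In a complete table, a vertex with arcs of two colors has only two arcs. -/
lemma eq_or_eq_of_mem_outs (hf : IsColorTable f) (hC : NoProperC4 f) (hr : Reduced f S)
    (hS : CompleteOn f S) {v b c : V} (hb : b ∈ outs f S v)
    (hc : c ∈ outs f S v) (hbc : f v b ≠ f v c) {d : V} (hd : d ∈ outs f S v) :
    d = b ∨ d = c := by
  classical
  have hmem : ∀ {x}, x ∈ outs f S v → x ∈ S ∧ x ≠ v := fun hx =>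
    ⟨(mem_outs.1 hx).1, (hf.ne_of_arc (mem_outs.1 hx).2).symm⟩
  have key : ∀ {b c : V}, b ∈ outs f S v → c ∈ outs f S v → f v b ≠ f v c → ∀ {y}, y ∈ S →
      Arc f S b y → y = v ∨ y = c := by
    intro b c hb hc hbc y hy hby
    have h := outs_subset hf hC hb hc hbc (mem_outs.2 ⟨hy, hby⟩)
    rw [mem_insert, mem_nonNeighbors] at h
    refine h.imp_right fun h => ?_
    by_contra hyc
    exact hS c (hmem hc).1 y hy (Ne.symm hyc) h.2
  by_contra! hne
  have hbc' : b ≠ c := fun h => hbc (h ▸ rfl)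
  by_cases hdc : f v d = f v c
  · rcases hr c (hmem hc).1 d (hmem hd).1 (hS c (hmem hc).1 d (hmem hd).1 hne.2.symm) with h | h
    · rcases key hc hb hbc.symm (hmem hd).1 h with h | h
      exacts [(hmem hd).2 h, hne.1 h]
    · rcases key hd hb (by rw [hdc]; exact hbc.symm) (hmem hc).1 h with h | h
      exacts [(hmem hc).2 h, hbc' h.symm]
  · rcases hr b (hmem hb).1 d (hmem hd).1 (hS b (hmem hb).1 d (hmem hd).1 hne.1.symm) with h | h
    · rcases key hb hc hbc (hmem hd).1 h with h | h
      exacts [(hmem hd).2 h, hne.2 h]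
    · rcases key hd hc hdc (hmem hb).1 h with h | h
      exacts [(hmem hb).2 h, hbc' h]

/-- If there is an arc from `v` to `x` but none back, then all arcs from `v` have one color. -/
lemma color_eq_of_not_arc (hf : IsColorTable f) (hC : NoProperC4 f) (hr : Reduced f S)
    (hS : CompleteOn f S) {v x w : V} (hv : v ∈ S) (hx : x ∈ S) (hw : w ∈ outs f S v)
    (hvx : Arc f S v x) (hxv : ¬ Arc f S x v) : f v x = f v w := by
  by_contra hne
  refine hxv ⟨by rw [hf.symm]; exact hvx.1, fun z hz hzx => ?_⟩
  by_contra hzx'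
  have hzv : z ≠ v := by
    rintro rfl
    exact hvx.1 (by rw [← hzx, hf.irrefl])
  -- A second edge `vz` of the color of `vx` would be a third arc from `v`, or an arc into `v` whose
  -- color is not unique there.
  rcases hr v hv z hz (hS v hv z hz hzv.symm) with h | h
  · rcases eq_or_eq_of_mem_outs hf hC hr hS (mem_outs.2 ⟨hx, hvx⟩) hw hne (mem_outs.2 ⟨hz, h⟩)
      with h | h
    · exact hzx' h
    · exact hne (by rw [← hzx, h])
  · exact hzx' (h.2 x hx hzx.symm).symm

/-- If a directed triangle in a complete table sends an arc to an outer vertex, then that vertex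
sends no arc to the triangle. -/
lemma not_arc_of_directed_triangle (hf : IsColorTable f) (hC : NoProperC4 f) {u v w x : V}
    (hu : u ∈ S) (hv : v ∈ S) (hw : w ∈ S) (hx : x ∈ S) (hxu : x ≠ u) (hxv : x ≠ v) (hxw : x ≠ w)
    (huv : Arc f S u v) (hvw : Arc f S v w) (hwu : Arc f S w u) (hux : Arc f S u x)
    (hr : Reduced f S) (hS : CompleteOn f S) :
    ¬ Arc f S x u ∧ ¬ Arc f S x v ∧ ¬ Arc f S x w := by
  have h1 : ¬ Arc f S x v := fun h =>
    not_directed_C4 hf hC hu hx hv hw (hf.ne_of_arc huv) hxw hux h hvw hwu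
  have h1' := (hr x hx v hv (hS x hx v hv hxv)).resolve_left h1
  have h2 : ¬ Arc f S x w := fun h =>
    not_directed_C4 hf hC hv hx hw hu (hf.ne_of_arc hvw) hxu h1' h hwu huv
  have h2' := (hr x hx w hw (hS x hx w hw hxw)).resolve_left h2
  exact ⟨fun h => not_directed_C4 hf hC hw hx hu hv (hf.ne_of_arc hwu) hxv h2' h huv hvw, h1, h2⟩

/-- The outermost layer of a complete table without properly colored 4-cycles. -/
lemma exists_layer (hf : IsColorTable f) (hC : NoProperC4 f) (hr : Reduced f S)
    (hS : CompleteOn f S) (hcard : 4 ≤ S.card) :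
    (∃ v ∈ S, ∃ k, ∀ x ∈ S, x ≠ v → Arc f S v x ∧ f v x = k) ∨
    ∃ u ∈ S, ∃ v ∈ S, ∃ w ∈ S, ∃ r b g, u ≠ v ∧ v ≠ w ∧ u ≠ w ∧ r ≠ b ∧ b ≠ g ∧ r ≠ g ∧
      f u v = r ∧ f v w = b ∧ f u w = g ∧ w ∉ outs f S u ∧
      ∀ x ∈ S, x ≠ u → x ≠ v → x ≠ w →
        (Arc f S u x ∧ f u x = r) ∧ (Arc f S v x ∧ f v x = b) ∧ (Arc f S w x ∧ f w x = g) := by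
  classical
  obtain ⟨u, hu, hmax⟩ := exists_max_image S (fun v => (outs f S v).card)
    (card_pos.1 (by omega))
  by_cases hall : ∀ x ∈ S, x ≠ u → Arc f S u x
  · refine Or.inl ⟨u, hu, ?_⟩
    obtain ⟨y, hy, hyu⟩ := exists_mem_ne (by omega : 1 < S.card) u
    refine ⟨f u y, fun x hx hxu => ⟨hall x hx hxu, ?_⟩⟩
    by_contra hne
    have hsub : S ⊆ {u, x, y} := by
      intro d hd
      simp only [mem_insert, mem_singleton]
      by_cases hdu : d = u
      · exact Or.inl hdu
      · exact Or.inr (eq_or_eq_of_mem_outs hf hC hr hS (mem_outs.2 ⟨hx, hall x hx hxu⟩)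
          (mem_outs.2 ⟨hy, hall y hy hyu⟩) hne (mem_outs.2 ⟨hd, hall d hd hdu⟩))
    have := (card_le_card hsub).trans card_le_three
    omega
  · push Not at hall
    obtain ⟨w, hw, hwu, huw⟩ := hall
    have hwu' := (hr u hu w hw (hS u hu w hw hwu.symm)).resolve_left huw
    -- Otherwise `w` would have larger out-degree than `u`. So `u → v → w → u` is a directed
    -- triangle.
    obtain ⟨v, hv, hvw⟩ : ∃ v ∈ outs f S u, v ∉ outs f S w := by
      by_contra! hcon
      have h1 : insert u (outs f S u) ⊆ outs f S w :=
        insert_subset (mem_outs.2 ⟨hu, hwu'⟩) hcon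
      have h2 := card_le_card h1
      rw [card_insert_of_notMem fun h => hf.ne_of_arc (mem_outs.1 h).2 rfl] at h2
      have h3 := hmax w hw
      omega
    rw [mem_outs] at hv
    obtain ⟨hv, huv⟩ := hv
    have hwv : w ≠ v := by
      rintro rfl
      exact huw huv
    have hvw' := (hr w hw v hv (hS w hw v hv hwv)).resolve_left fun h => hvw (mem_outs.2 ⟨hv, h⟩)
    have huv' := hf.ne_of_arc huv
    have hdom : ∀ x ∈ S, x ≠ u → x ≠ v → x ≠ w →
        ¬ Arc f S x u ∧ ¬ Arc f S x v ∧ ¬ Arc f S x w := by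
      intro x hx hxu hxv hxw
      by_cases h1 : Arc f S u x
      · exact not_arc_of_directed_triangle hf hC hu hv hw hx hxu hxv hxw huv hvw' hwu' h1 hr hS
      by_cases h2 : Arc f S v x
      · have := not_arc_of_directed_triangle hf hC hv hw hu hx hxv hxw hxu hvw' hwu' huv h2 hr hS
        tauto
      by_cases h3 : Arc f S w x
      · have := not_arc_of_directed_triangle hf hC hw hu hv hx hxw hxu hxv hwu' huv hvw' h3 hr hS
        tauto
      have h1' := (hr u hu x hx (hS u hu x hx hxu.symm)).resolve_left h1
      have h2' := (hr v hv x hx (hS v hv x hx hxv.symm)).resolve_left h2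
      -- If the triangle sends no arc to `x`, then `x` beats `u` and all its out-neighbors, against
      -- maximality; an arc from `y` to `x` would close the directed cycle `x → u → v → y → x`.
      have h4 : insert u (outs f S u) ⊆ outs f S x := by
        refine insert_subset (mem_outs.2 ⟨hu, h1'⟩) fun y hy => mem_outs.2 ⟨(mem_outs.1 hy).1, ?_⟩
        rw [mem_outs] at hy
        by_cases hyv : y = v
        · exact hyv ▸ h2'
        have hyw : y ≠ w := fun h => huw (h ▸ hy.2)
        have hyu := (hf.ne_of_arc hy.2).symm
        have hyx : y ≠ x := fun h => h1 (h ▸ hy.2)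
        have hn := (not_arc_of_directed_triangle hf hC hu hv hw hy.1 hyu hyv hyw huv hvw' hwu' hy.2
          hr hS).2.1
        have hvy := (hr y hy.1 v hv (hS y hy.1 v hv hyv)).resolve_left hn
        refine (hr x hx y hy.1 (hS x hx y hy.1 hyx.symm)).resolve_right fun h => ?_
        exact not_directed_C4 hf hC hx hu hv hy.1 hxv hyu.symm h1' huv hvy h
      have h5 := card_le_card h4
      rw [card_insert_of_notMem fun h => hf.ne_of_arc (mem_outs.1 h).2 rfl] at h5
      have h6 := hmax x hx
      omega
    refine Or.inr ⟨u, hu, v, hv, w, hw, f u v, f v w, f u w, huv', hwv.symm, hwu.symm, ?_, ?_, ?_,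
      rfl, rfl, rfl, fun h => huw (mem_outs.1 h).2, ?_⟩
    · exact fun h => hwu (huv.2 w hw (h.symm.trans (hf.symm u v)))
    · exact fun h => huv' (hvw'.2 u hu ((hf.symm w u).trans (h.symm.trans (hf.symm v w))))
    · exact fun h => hwv.symm (hwu'.2 v hv h)
    · intro x hx hxu hxv hxw
      obtain ⟨h1, h2, h3⟩ := hdom x hx hxu hxv hxw
      have a1 := (hr x hx u hu (hS x hx u hu hxu)).resolve_left h1
      have a2 := (hr x hx v hv (hS x hx v hv hxv)).resolve_left h2
      have a3 := (hr x hx w hw (hS x hx w hw hxw)).resolve_left h3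
      exact ⟨⟨a1, color_eq_of_not_arc hf hC hr hS hu hx (mem_outs.2 ⟨hv, huv⟩) a1 h1⟩,
        ⟨a2, color_eq_of_not_arc hf hC hr hS hv hx (mem_outs.2 ⟨hw, hvw'⟩) a2 h2⟩,
        ⟨a3, (color_eq_of_not_arc hf hC hr hS hw hx (mem_outs.2 ⟨hu, hwu'⟩) a3 h3).trans
          (hf.symm w u)⟩⟩

open Classical in
/-- Deleting a vertex whose outgoing arcs have one color loses at most `|S|`. -/
lemma colorDegreeSum_le_of_outs (hf : IsColorTable f) {v : V} (hv : v ∈ S) {k : Option α}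
    (h : ∀ x ∈ outs f S v, f v x = k) :
    colorDegreeSum f S ≤ colorDegreeSum f (S.erase v) + S.card := by
  have h1 := colorDegreeSum_add_le hf hv
  have h2 := card_nonNeighbors_pos hf hv
  have h3 : (outColors f S v).card ≤ 1 := by
    rw [← card_singleton k]
    refine card_le_card fun c hc => ?_
    simp only [outColors, mem_image] at hc
    obtain ⟨x, hx, rfl⟩ := hc
    exact mem_singleton.2 (h x hx)
  omega

/-- In the extremal case, a reduced table is layered over a rainbow triangle. -/
theorem exists_layeredOver {G : SimpleGraph V} {C : G.EdgeLabeling α}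
    (hfC : ∀ x y k, HasColor C x y k ↔ f x y = some k) (hf : IsColorTable f) (hC : NoProperC4 f)
    (hr : Reduced f S) (hne : S.Nonempty)
    (hS : 2 * colorDegreeSum f S = S.card * (S.card + 1)) :
    ∃ T : Set V, IsRainbowTriangle C T ∧ LayeredOver C T (S : Set V) := by
  classical
  induction S using Finset.strongInduction with
  | H S ih =>
  have hcomp := (two_mul_colorDegreeSum_le hf hC hr).2 hS
  have hcol : ∀ {x y k}, x ∈ S → y ∈ S → x ≠ y → f x y = k → ∃ c, k = some c := by
    rintro x y k hx hy hxy rfl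
    exact Option.ne_none_iff_exists'.1 (hcomp x hx y hy hxy)
  -- The color of an arc from `v` is unique at its head, so it cannot reappear inside `R`.
  have hfree : ∀ {v R k}, v ∈ S → v ∉ R → R ⊆ S → (∀ x ∈ R, Arc f S v x ∧ f v x = some k) →
      ColorFreeOn C k (R : Set V) := by
    intro v R k hv hvR hRS h y hy z hz hyz
    rw [hfC] at hyz
    obtain ⟨h1, h2⟩ := h y hy
    have : z = v := h1.2 z (hRS hz) (by rw [hyz, hf.symm, h2])
    exact hvR (this ▸ hz)
  rcases Nat.lt_or_ge S.card 4 with hlt | hge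
  · have h1 := colorDegreeSum_add_card_le (S := S) hf
    have h0 := card_pos.2 hne
    have h3 : S.card = 3 := by interval_cases S.card <;> omega
    rw [h3] at hS
    have h4 := colorDegreeIn_eq_of_card_three hf h3 (by omega)
    obtain ⟨x, y, z, hxy, hxz, hyz, rfl⟩ := card_eq_three.1 h3
    have hx : x ∈ ({x, y, z} : Finset V) := by simp
    have hy : y ∈ ({x, y, z} : Finset V) := by simp
    have hz : z ∈ ({x, y, z} : Finset V) := by simp
    have hcolors : ∀ {a b c : V}, ({x, y, z} : Finset V) = {a, b, c} → f a b ≠ f a c := by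
      intro a b c habc hbc
      have h5 := h4 a (habc ▸ by simp)
      unfold colorDegreeIn at h5
      have h6 : ((({x, y, z} : Finset V).image (f a)).erase none) ⊆ {f a b} := by
        intro k hk
        rw [habc] at hk
        simp only [mem_erase, mem_image, mem_insert, mem_singleton] at hk ⊢
        obtain ⟨hk, d, rfl | rfl | rfl, rfl⟩ := hk
        · exact absurd (hf.irrefl _) hk
        · rfl
        · exact hbc.symm
      have := card_le_card h6
      rw [card_singleton] at this
      omega
    obtain ⟨r, hr'⟩ := hcol hx hy hxy rfl
    obtain ⟨b, hb⟩ := hcol hy hz hyz rfl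
    obtain ⟨g, hg⟩ := hcol hx hz hxz rfl
    have e1 := hcolors (a := x) (b := y) (c := z) rfl
    have e2 := hcolors (a := y) (b := x) (c := z) (by ext; simp; tauto)
    have e3 := hcolors (a := z) (b := x) (c := y) (by ext; simp; tauto)
    rw [hf.symm y x] at e2
    rw [hf.symm z x, hf.symm z y] at e3
    rw [hr', hg] at e1
    rw [hr', hb] at e2
    rw [hg, hb] at e3
    refine ⟨_, ⟨x, y, z, r, b, g, rfl, (hfC _ _ _).2 hr', (hfC _ _ _).2 hb, (hfC _ _ _).2 hg,
      fun h => e2 (h ▸ rfl), fun h => e3 (h ▸ rfl), fun h => e1 (h ▸ rfl)⟩, ?_⟩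
    convert LayeredOver.center using 1
    simp
  · rcases exists_layer hf hC hr hcomp hge with ⟨v, hv, k, hk⟩ | ⟨u, hu, v, hv, w, hw, r, b, g,
      huv, hvw, huw, hrb, hbg, hrg, hur, hvb, hug, hout, hdom⟩
    · obtain ⟨y, hy, hyv⟩ := exists_mem_ne (by omega : 1 < S.card) v
      obtain ⟨c, rfl⟩ := hcol hv hy hyv.symm (hk y hy hyv).2
      have h1 := colorDegreeSum_le_of_outs hf hv (k := some c) fun x hx =>
        (hk x (mem_outs.1 hx).1 (hf.ne_of_arc (mem_outs.1 hx).2).symm).2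
      have hr' := hr.mono (erase_subset v S)
      have h2 := (two_mul_colorDegreeSum_le hf hC hr').1
      have h3 := card_erase_add_one hv
      have h4 : 2 * colorDegreeSum f (S.erase v) =
          (S.erase v).card * ((S.erase v).card + 1) := by
        rw [← h3] at hS h1
        refine le_antisymm h2 (by nlinarith)
      obtain ⟨T, hT, hL⟩ := ih _ (erase_ssubset hv) hr' ⟨y, mem_erase.2 ⟨hyv, hy⟩⟩ h4
      have hk' : ∀ x ∈ S.erase v, Arc f S v x ∧ f v x = some c := fun x hx =>
        hk x (mem_of_mem_erase hx) (ne_of_mem_erase hx)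
      refine ⟨T, hT, ?_⟩
      have := LayeredOver.vertex hL v (by simp) c
        (hfree hv (notMem_erase v S) (erase_subset v S) hk') fun x hx =>
          (hfC _ _ _).2 (hk' x hx).2
      rwa [← coe_insert, insert_erase hv] at this
    · obtain ⟨r, rfl⟩ := hcol hu hv huv hur
      obtain ⟨b, rfl⟩ := hcol hv hw hvw hvb
      obtain ⟨g, rfl⟩ := hcol hu hw huw hug
      have hv1 : v ∈ S.erase u := mem_erase.2 ⟨huv.symm, hv⟩
      have hw1 : w ∈ S.erase u := mem_erase.2 ⟨huw.symm, hw⟩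
      have hw2 : w ∈ (S.erase u).erase v := mem_erase.2 ⟨hvw.symm, hw1⟩
      set R := ((S.erase u).erase v).erase w with hR
      have hRmem : ∀ {x}, x ∈ R ↔ x ∈ S ∧ x ≠ u ∧ x ≠ v ∧ x ≠ w := by
        intro x
        simp only [hR, mem_erase]
        tauto
      have hRS : R ⊆ S := fun x hx => (hRmem.1 hx).1
      have hRdom : ∀ x ∈ R, (Arc f S u x ∧ f u x = some r) ∧ (Arc f S v x ∧ f v x = some b) ∧
          (Arc f S w x ∧ f w x = some g) := fun x hx => by
        obtain ⟨h1, h2, h3, h4⟩ := hRmem.1 hx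
        exact hdom x h1 h2 h3 h4
      have l1 := colorDegreeSum_le_of_outs hf hu (k := some r) (by
        intro x hx
        by_cases hxv : x = v
        · rw [hxv, hur]
        -- The edge `uw` has color `g`; it does not spoil the count because it is not an arc from
        -- `u`.
        · have hxw : x ≠ w := fun h => hout (h ▸ hx)
          exact (hdom x (mem_outs.1 hx).1 (hf.ne_of_arc (mem_outs.1 hx).2).symm hxv hxw).1.2)
      have l2 := colorDegreeSum_le_of_outs hf hv1 (k := some b) (by
        intro x hx
        have h1 := mem_outs.1 hx
        by_cases hxw : x = w
        · rw [hxw, hvb]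
        · exact (hdom x (mem_of_mem_erase h1.1) (ne_of_mem_erase h1.1) (hf.ne_of_arc h1.2).symm
            hxw).2.1.2)
      have l3 := colorDegreeSum_le_of_outs hf hw2 (k := some g) (by
        intro x hx
        have h1 := mem_outs.1 hx
        simp only [mem_erase] at h1
        exact (hdom x h1.1.2.2 h1.1.2.1 h1.1.1 (hf.ne_of_arc h1.2).symm).2.2.2)
      rw [← hR] at l3
      have c1 := card_erase_add_one hu
      have c2 := card_erase_add_one hv1
      have c3 := card_erase_add_one hw2
      rw [← hR] at c3
      have hr' := hr.mono hRS
      have h2 := (two_mul_colorDegreeSum_le hf hC hr').1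
      have h4 : 2 * colorDegreeSum f R = R.card * (R.card + 1) := by
        have hc : S.card = R.card + 3 := by omega
        rw [hc] at hS
        refine le_antisymm h2 ?_
        -- The three deletions cost at most |R|+3, |R|+2 and |R|+1.
        have : 2 * colorDegreeSum f S ≤ 2 * colorDegreeSum f R + 6 * R.card + 12 := by omega
        nlinarith
      obtain ⟨T, hT, hL⟩ := ih R (ssubset_of_subset_of_ne hRS fun h => (hRmem.1 (h ▸ hu)).2.1 rfl)
        hr' (card_pos.1 (by omega)) h4
      refine ⟨T, hT, ?_⟩
      have huR : u ∉ R := fun h => (hRmem.1 h).2.1 rfl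
      have hvR : v ∉ R := fun h => (hRmem.1 h).2.2.1 rfl
      have hwR : w ∉ R := fun h => (hRmem.1 h).2.2.2 rfl
      have := LayeredOver.triangle hL u v w (by simpa) (by simpa) (by simpa) r b g
        (fun h => hrb (h ▸ rfl)) (fun h => hbg (h ▸ rfl)) (fun h => hrg (h ▸ rfl))
        (hfree hu huR hRS fun x hx => (hRdom x hx).1)
        (hfree hv hvR hRS fun x hx => (hRdom x hx).2.1)
        (hfree hw hwR hRS fun x hx => (hRdom x hx).2.2)
        ((hfC _ _ _).2 hur) ((hfC _ _ _).2 hvb) ((hfC _ _ _).2 hug)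
        (fun x hx => (hfC _ _ _).2 (hRdom x hx).1.2)
        (fun x hx => (hfC _ _ _).2 (hRdom x hx).2.1.2)
        (fun x hx => (hfC _ _ _).2 (hRdom x hx).2.2.2)
      convert this using 1
      ext x
      simp only [Finset.mem_coe, Set.mem_union, Set.mem_insert_iff, Set.mem_singleton_iff, hRmem]
      constructor
      · tauto
      · rintro ((rfl | rfl | rfl) | h)
        exacts [hu, hv, hw, h.1]

end Layers

/-! ### Deleting edges without changing color degrees. -/

section Reduction

variable {V α : Type*}

open Classical in
/-- Delete from `f` the edge `xy`. -/
noncomputable def deleteEdge (f : V → V → Option α) (x y : V) : V → V → Option α :=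
  fun a b => if a = x ∧ b = y ∨ a = y ∧ b = x then none else f a b

/-- The number of adjacent pairs of a table. -/
noncomputable def numAdj [Fintype V] (f : V → V → Option α) : ℕ := by
  classical
  exact ({p : V × V | f p.1 p.2 ≠ none} : Finset (V × V)).card

/-- Deleting superfluous edges turns a table into a reduced one with the same color degrees. -/
lemma exists_reduced [Fintype V] {f : V → V → Option α} (hf : IsColorTable f) :
    ∃ f' : V → V → Option α, IsColorTable f' ∧ Reduced f' univ ∧
      (∀ x y, f' x y = none ∨ f' x y = f x y) ∧
      ∀ v, colorDegreeIn f' univ v = colorDegreeIn f univ v := by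
  classical
  induction hn : numAdj f using Nat.strong_induction_on generalizing f with
  | _ n ih =>
  by_cases hr : Reduced f univ
  · exact ⟨f, hf, hr, fun _ _ => Or.inr rfl, fun _ => rfl⟩
  simp only [Reduced, not_forall, not_or] at hr
  obtain ⟨x, -, y, -, hxy, h1, h2⟩ := hr
  have hyx : f y x ≠ none := by rwa [hf.symm]
  simp only [Arc, not_and, not_forall] at h1 h2
  obtain ⟨z, -, hz, hzx⟩ := h1 hxy
  obtain ⟨t, -, ht, hty⟩ := h2 hyx
  have hne : x ≠ y := fun h => hxy (h ▸ hf.irrefl x)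
  have hg : IsColorTable (deleteEdge f x y) := by
    constructor
    · intro a b
      unfold deleteEdge
      rw [hf.symm a b]
      exact if_congr (by tauto) rfl rfl
    · intro a
      simp [deleteEdge, hf.irrefl]
  have hsub : ∀ a b, deleteEdge f x y a b = none ∨ deleteEdge f x y a b = f a b := by
    intro a b
    unfold deleteEdge
    split_ifs <;> simp
  have hdeg : ∀ v, colorDegreeIn (deleteEdge f x y) univ v = colorDegreeIn f univ v := by
    intro v
    unfold colorDegreeIn
    congr 1
    ext k
    simp only [mem_erase, mem_image, mem_univ, true_and, and_congr_right_iff]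
    refine fun hk => ⟨?_, ?_⟩
    · rintro ⟨w, rfl⟩
      exact ⟨w, ((hsub v w).resolve_left hk).symm⟩
    · rintro ⟨w, rfl⟩
      by_cases hc : v = x ∧ w = y ∨ v = y ∧ w = x
      -- The deleted color survives at `x` on `xt` and at `y` on `yz`.
      · rcases hc with ⟨rfl, rfl⟩ | ⟨rfl, rfl⟩
        · exact ⟨t, by rw [deleteEdge, if_neg (by tauto), ht]⟩
        · exact ⟨z, by rw [deleteEdge, if_neg (by tauto), hz]⟩
      · exact ⟨w, if_neg hc⟩
  have hlt : numAdj (deleteEdge f x y) < n := by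
    rw [← hn]
    unfold numAdj
    refine card_lt_card (ssubset_iff_of_subset ?_ |>.2 ⟨(x, y), by simpa, by simp [deleteEdge]⟩)
    intro p hp
    simp only [mem_filter, mem_univ, true_and] at hp ⊢
    rwa [← (hsub p.1 p.2).resolve_left hp]
  obtain ⟨f', hf', hr', hsub', hdeg'⟩ := ih _ hlt hg rfl
  refine ⟨f', hf', hr', fun a b => ?_, fun v => (hdeg' v).trans (hdeg v)⟩
  rcases hsub' a b with h | h
  · exact Or.inl h
  · rw [h]; exact hsub a b

lemma NoProperC4.of_sub {f f' : V → V → Option α} (hC : NoProperC4 f)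
    (h : ∀ x y, f' x y = none ∨ f' x y = f x y) : NoProperC4 f' := by
  intro a b c d hac hbd h1 h2 h3 h4
  have e1 := (h a b).resolve_left h1
  have e2 := (h b c).resolve_left h2
  have e3 := (h c d).resolve_left h3
  have e4 := (h d a).resolve_left h4
  rw [e1] at h1
  rw [e2] at h2
  rw [e3] at h3
  rw [e4] at h4
  rw [e1, e2, e3, e4]
  exact hC a b c d hac hbd h1 h2 h3 h4

end Reduction

/-! ### Passing from edge labelings to color tables. -/

section Labeling

variable {V α : Type*} {G : SimpleGraph V}

open Classical in
/-- The color table of an edge-colored graph. -/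
noncomputable def colorTable (C : G.EdgeLabeling α) (x y : V) : Option α :=
  if h : G.Adj x y then some (C.get x y h) else none

lemma hasColor_iff (C : G.EdgeLabeling α) (x y : V) (k : α) :
    HasColor C x y k ↔ colorTable C x y = some k := by
  by_cases h : G.Adj x y <;> simp [HasColor, colorTable, h]

lemma isColorTable_colorTable (C : G.EdgeLabeling α) : IsColorTable (colorTable C) := by
  constructor
  · intro x y
    by_cases h : G.Adj x y
    · simp [colorTable, h, h.symm, SimpleGraph.EdgeLabeling.get_comm x y]
    · simp [colorTable, h, G.adj_comm y x]
  · intro x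
    simp [colorTable]

lemma noProperC4_colorTable {C : G.EdgeLabeling α} (hC : ¬ HasProperlyColoredC4 C) :
    NoProperC4 (colorTable C) := by
  intro a b c d hac hbd h1 h2 h3 h4 e1 e2 e3 e4
  obtain ⟨k₁, h1⟩ := Option.ne_none_iff_exists'.1 h1
  obtain ⟨k₂, h2⟩ := Option.ne_none_iff_exists'.1 h2
  obtain ⟨k₃, h3⟩ := Option.ne_none_iff_exists'.1 h3
  obtain ⟨k₄, h4⟩ := Option.ne_none_iff_exists'.1 h4
  rw [h1, h2] at e1
  rw [h2, h3] at e2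
  rw [h3, h4] at e3
  rw [h4, h1] at e4
  simp only [ne_eq, Option.some.injEq] at e1 e2 e3 e4
  exact hC ⟨a, b, c, d, k₁, k₂, k₃, k₄, hac, hbd, (hasColor_iff _ _ _ _).2 h1,
    (hasColor_iff _ _ _ _).2 h2, (hasColor_iff _ _ _ _).2 h3, (hasColor_iff _ _ _ _).2 h4,
    e1, e2, e3, e4⟩

lemma colorDegreeIn_colorTable [Fintype V] (C : G.EdgeLabeling α) (v : V) :
    colorDegreeIn (colorTable C) univ v = colorDegree C v := by
  classical
  unfold colorDegreeIn colorDegree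
  rw [← Set.ncard_coe_finset, ← Set.ncard_image_of_injective _ (Option.some_injective α)]
  congr 1
  ext k
  cases k <;> simp [hasColor_iff]

end Labeling

end EdgeColoredGraph

theorem theorem7 {V α : Type*} [Fintype V] (G : SimpleGraph V) (C : G.EdgeLabeling α)
    (hn : 4 ≤ Fintype.card V) :
    (Fintype.card V * (Fintype.card V + 1) / 2 + 1 ≤ ∑ v, EdgeColoredGraph.colorDegree C v →
      EdgeColoredGraph.HasProperlyColoredC4 C) ∧
    (∑ v, EdgeColoredGraph.colorDegree C v = Fintype.card V * (Fintype.card V + 1) / 2 →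
      ¬ EdgeColoredGraph.HasProperlyColoredC4 C →
      G = ⊤ ∧ ∃ T : Set V, EdgeColoredGraph.IsRainbowTriangle C T ∧
        EdgeColoredGraph.LayeredOver C T Set.univ) := by
  obtain ⟨f, hf, hr, hsub, hdeg⟩ :=
    EdgeColoredGraph.exists_reduced (EdgeColoredGraph.isColorTable_colorTable C)
  have hsum : EdgeColoredGraph.colorDegreeSum f Finset.univ =
      ∑ v, EdgeColoredGraph.colorDegree C v :=
    Finset.sum_congr rfl fun v _ =>
      (hdeg v).trans (EdgeColoredGraph.colorDegreeIn_colorTable C v)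
  have heven := Nat.two_mul_div_two_of_even (Nat.even_mul_succ_self (Fintype.card V))
  constructor
  · intro h
    by_contra hC
    have := (EdgeColoredGraph.two_mul_colorDegreeSum_le hf
      ((EdgeColoredGraph.noProperC4_colorTable hC).of_sub hsub) hr).1
    rw [hsum, Finset.card_univ] at this
    omega
  · intro h hC
    have hC' := (EdgeColoredGraph.noProperC4_colorTable hC).of_sub hsub
    have heq : 2 * EdgeColoredGraph.colorDegreeSum f Finset.univ =
        (Finset.univ : Finset V).card * ((Finset.univ : Finset V).card + 1) := by
      rw [hsum, Finset.card_univ]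
      omega
    have hcomp := (EdgeColoredGraph.two_mul_colorDegreeSum_le hf hC' hr).2 heq
    -- Since the reduced table is complete, no edge was deleted, so the layers found are layers of
    -- `C` itself.
    have hfC : ∀ x y, f x y = EdgeColoredGraph.colorTable C x y := by
      intro x y
      by_cases hxy : x = y
      · rw [hxy, hf.irrefl, (EdgeColoredGraph.isColorTable_colorTable C).irrefl]
      · exact (hsub x y).resolve_left (hcomp x (Finset.mem_univ x) y (Finset.mem_univ y) hxy)
    refine ⟨?_, ?_⟩
    · ext x y
      rw [SimpleGraph.top_adj]
      refine ⟨fun h => h.ne, fun hxy => ?_⟩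
      by_contra hadj
      refine hcomp x (Finset.mem_univ x) y (Finset.mem_univ y) hxy ?_
      rw [hfC, EdgeColoredGraph.colorTable, dif_neg hadj]
    · have := EdgeColoredGraph.exists_layeredOver (C := C) (S := Finset.univ)
        (fun x y k => by rw [EdgeColoredGraph.hasColor_iff, hfC]) hf hC' hr
        (Finset.card_pos.1 (by rw [Finset.card_univ]; omega)) heq
      rwa [Finset.coe_univ] at this
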